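/- Let $n\ge 1$, let $\mathbb D^n=\{z\in\mathbb C^n: |z_i|<1 \text{ for all } i\}$ and $\mathbb T^n=\{z\in\mathbb C^n: |z_i|=1 \text{ for all } i\}$. An inner function on $\mathbb D^n$ is a bounded holomorphic function $\phi:\mathbb D^n\to\mathbb C$ whose radial limits $\lim_{r\to1^-}\phi(r\zeta)$ exist and have modulus one for almost every $\zeta\in\mathbb T^n$; it is rational if there are polynomials $P$ and $Q\neq 0$ with $\phi Q=P$ on $\mathbb D^n$. The singular set $S_\phi$ is the set of points $\zeta\in\mathbb T^n$ to which $\phi$ cannot be continuously extended from $\mathbb D^n$, i.e. such that $\lim_{z\to\zeta,\,z\in\mathbb D^n}\phi(z)$ does not exist in $\mathbb C$. An algebraic set in $\mathbb C^n$ is a finite intersection of zero sets of polynomials, and its dimension is the Krull dimension of its coordinate ring. Let $\phi$ be a rational inner function on $\mathbb D^n$. If $n\ge 2$, then $S_\phi$ is contained in an algebraic set $A\subseteq\mathbb C^n$ of dimension $n-2$. If $n=1$, then $S_\phi=\emptyset$. Moreover, whenever $p$ is a polynomial without zeros in $\mathbb D^n$ and $h\in\mathbb N^n$ are such that $\phi(z)=z^h\,\tilde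 p(z)/p(z)$ on $\mathbb D^n$, where $\tilde p(z)=z^{d}\,\overline{p(1/\bar z_1,\dots,1/\bar z_n)}$ and $d=(d_1,\dots,d_n)$ is the multidegree of $p$ ($d_i$ being the degree of $p$ in $z_i$), one has $S_\phi\subseteq Z_p\cap Z_{\tilde p}$, where $Z_q$ denotes the zero set of $q$ in $\mathbb C^n$. -/

import Mathlib

open MvPolynomial Filter Topology MeasureTheory

noncomputable section

/-- The open unit polydisk `𝔻ⁿ` in `ℂⁿ`. -/
def polydisk (n : ℕ) : Set (Fin n → ℂ) := {z | ∀ i, ‖z i‖ < 1}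

/-- The `n`-torus `𝕋ⁿ`, the distinguished boundary of the polydisk. -/
def torus (n : ℕ) : Set (Fin n → ℂ) := {z | ∀ i, ‖z i‖ = 1}

/-- The point `(e^{iθ₁}, …, e^{iθₙ})` of the torus. -/
def torusPoint {n : ℕ} (θ : Fin n → ℝ) : Fin n → ℂ :=
  fun i => Complex.exp ((θ i : ℂ) * Complex.I)

/-- Inner functions on `𝔻ⁿ`: holomorphic, bounded, with radial boundary values that exist and have
modulus one at almost every point of the torus. A set of points of `𝕋ⁿ` is null exactly when the
set of its angle vectors `θ ∈ ℝⁿ` is Lebesgue null. Only the values of `φ` on `𝔻ⁿ` matter. -/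
structure IsInner {n : ℕ} (φ : (Fin n → ℂ) → ℂ) : Prop where
  holomorphic : DifferentiableOn ℂ φ (polydisk n)
  bounded : ∃ C : ℝ, ∀ z ∈ polydisk n, ‖φ z‖ ≤ C
  radial : ∀ᵐ θ : Fin n → ℝ, ∃ w : ℂ,
    Tendsto (fun r : ℝ => φ (fun i => (r : ℂ) * torusPoint θ i)) (𝓝[<] 1) (𝓝 w) ∧ ‖w‖ = 1

/-- `φ` agrees on `𝔻ⁿ` with a quotient of polynomials. The denominator is a nonzero polynomial, but
nothing is required of its zero set. -/
def IsRationalOnPolydisk {n : ℕ} (φ : (Fin n → ℂ) → ℂ) : Prop :=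
  ∃ P Q : MvPolynomial (Fin n) ℂ, Q ≠ 0 ∧ ∀ z ∈ polydisk n, φ z * eval z Q = eval z P

/-- Rational inner functions on `𝔻ⁿ`. -/
def IsRationalInner {n : ℕ} (φ : (Fin n → ℂ) → ℂ) : Prop :=
  IsInner φ ∧ IsRationalOnPolydisk φ

/-- The singular set: the points of `𝕋ⁿ` to which `φ` cannot be extended continuously
from `𝔻ⁿ`. -/
def singularSet {n : ℕ} (φ : (Fin n → ℂ) → ℂ) : Set (Fin n → ℂ) :=
  {ζ | ζ ∈ torus n ∧ ¬ ∃ w : ℂ, Tendsto φ (𝓝[polydisk n] ζ) (𝓝 w)}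

/-- The zero set `Z_p` of a polynomial. -/
def zeroSet {n : ℕ} (p : MvPolynomial (Fin n) ℂ) : Set (Fin n → ℂ) := {z | eval z p = 0}

/-- Algebraic sets in `ℂⁿ`: finite intersections of zero sets of polynomials. -/
def IsAlgebraicSet {n : ℕ} (A : Set (Fin n → ℂ)) : Prop :=
  ∃ s : Finset (MvPolynomial (Fin n) ℂ), A = ⋂ p ∈ s, zeroSet p

/-- The dimension of an algebraic set: the Krull dimension of its coordinate ring
(`⊥` for the empty set). -/
def algDim {n : ℕ} (A : Set (Fin n → ℂ)) : WithBot ℕ∞ :=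
  ringKrullDim (MvPolynomial (Fin n) ℂ ⧸ vanishingIdeal ℂ A)

/-- The reflection `p^∼(z) = z^d * conj (p (1 / conj z))` of a polynomial `p` of multidegree
`d = (d₁, …, dₙ)`, written out on coefficients. -/
def reflection {n : ℕ} (p : MvPolynomial (Fin n) ℂ) : MvPolynomial (Fin n) ℂ :=
  ∑ m ∈ p.support, C (star (p.coeff m)) * ∏ i, X i ^ (p.degreeOf i - m i)

theorem eval_reflection {n : ℕ} (p : MvPolynomial (Fin n) ℂ) (z : Fin n → ℂ)
    (hz : ∀ i, z i ≠ 0) :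
    eval z (reflection p) =
      (∏ i, z i ^ p.degreeOf i) * star (eval (fun i => 1 / star (z i)) p) := by
  rw [reflection, map_sum, eval_eq' (fun i => 1 / star (z i)) p, star_sum, Finset.mul_sum]
  refine Finset.sum_congr rfl fun m hm => ?_
  simp only [map_mul, map_prod, map_pow, eval_C, eval_X, star_mul']
  rw [mul_left_comm, star_prod, ← Finset.prod_mul_distrib]
  congr 1
  refine Finset.prod_congr rfl fun i _ => ?_
  have hle : m i ≤ p.degreeOf i := monomial_le_degreeOf i hm
  rw [pow_sub₀ _ (hz i) hle]
  simp

end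

/-! The theorem rests on two facts.

*Analysis.* Suppose `φ * Q = P` on the polydisk and `ζ` is a point of the torus at which `φ` has no
limit. Then `Q ζ = 0`, since otherwise `P / Q` is continuous at `ζ`. As `φ` is bounded, `P = φ * Q`
tends to `0` at `ζ`, so `P ζ = 0` as well. A common factor of `P` and `Q` can be cancelled, because
the complement of the zero set of a nonzero polynomial is dense; so the singular set lies in the
common zero set of two coprime polynomials (`singularSet_subset_of_mul_eq`,
`IsRationalInner.exists_isRelPrime`).

*Algebra.* A prime `𝔭` of a factorial ring that contains two coprime elements has height at least
two: it contains a prime factor `f` of one of them, and `⊥ < (f) < 𝔭`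
(`two_le_height_of_isRelPrime`). In `ℂ[X₁, …, Xₙ]`, which has dimension `n`, this bounds the
dimension of the common zero set by `n - 2`, and forbids common zeros altogether if `n ≤ 1`.
To obtain dimension exactly `n - 2`, the linear subspace `{z₀ = z₁ = 0}` is adjoined.

For `φ = z ^ h * p^∼ / p` the analytic part gives `p ζ = 0`, and `p^∼ ζ` is a multiple of
`conj (p ζ)` since `1 / conj ζ = ζ` on the torus. -/

/-! ### Primes of height at least two -/

theorem two_le_height_of_isRelPrime {R : Type*} [CommRing R] [IsDomain R]
    [UniqueFactorizationMonoid R] {a b : R} (hab : IsRelPrime a b) (x : PrimeSpectrum R)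
    (ha : a ∈ x.asIdeal) (hb : b ∈ x.asIdeal) : 2 ≤ Order.height x := by
  have ha0 : a ≠ 0 := by
    rintro rfl
    exact x.isPrime.ne_top (Ideal.eq_top_of_isUnit_mem _ hb (isRelPrime_zero_left.mp hab))
  obtain ⟨f, hfx, hfa, hf⟩ : ∃ f ∈ x.asIdeal, f ∣ a ∧ Prime f := by
    have hprod := UniqueFactorizationMonoid.factors_prod ha0
    have hmem : (UniqueFactorizationMonoid.factors a).prod ∈ x.asIdeal :=
      (Ideal.mem_iff_of_associated hprod).mpr ha
    obtain ⟨f, hf, hfx⟩ := (x.isPrime.multiset_prod_mem_iff_exists_mem _).mp hmem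
    exact ⟨f, hfx, UniqueFactorizationMonoid.dvd_of_mem_factors hf,
      UniqueFactorizationMonoid.prime_of_factor f hf⟩
  let y : PrimeSpectrum R :=
    ⟨Ideal.span {f}, (Ideal.span_singleton_prime hf.ne_zero).mpr hf⟩
  have hyx : y < x := by
    refine lt_of_le_of_ne ((Ideal.span_singleton_le_iff_mem _).mpr hfx) fun h => ?_
    have hby : b ∈ y.asIdeal := h ▸ hb
    exact hf.not_isUnit (hab hfa (Ideal.mem_span_singleton.mp hby))
  have hby : (⊥ : PrimeSpectrum R) < y := by
    refine lt_of_le_of_ne bot_le fun h => hf.ne_zero ?_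
    have : f ∈ (⊥ : PrimeSpectrum R).asIdeal := h ▸ Ideal.mem_span_singleton_self f
    simpa using this
  calc (2 : ℕ∞) = 0 + 1 + 1 := by norm_num
    _ ≤ Order.height (⊥ : PrimeSpectrum R) + 1 + 1 := by gcongr; exact zero_le
    _ ≤ Order.height y + 1 := by gcongr; exact Order.height_add_one_le hby
    _ ≤ Order.height x := Order.height_add_one_le hyx

theorem Order.height_add_coheight_le_krullDim {α : Type*} [Preorder α] (a : α) :
    ((Order.height a + Order.coheight a : ℕ∞) : WithBot ℕ∞) ≤ Order.krullDim α := by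
  have : Nonempty α := ⟨a⟩
  rw [Order.krullDim_eq_iSup_height_add_coheight_of_nonempty]
  exact WithBot.coe_le_coe.mpr (le_iSup (fun a : α => Order.height a + Order.coheight a) a)

theorem ringKrullDim_quotient_le_of_two_le_height {R : Type*} [CommRing R] {m : ℕ}
    (hR : ringKrullDim R ≤ ((m + 2 : ℕ) : WithBot ℕ∞)) (I : Ideal R)
    (hI : ∀ x : PrimeSpectrum R, I ≤ x.asIdeal → 2 ≤ Order.height x) :
    ringKrullDim (R ⧸ I) ≤ (m : WithBot ℕ∞) := by
  rw [ringKrullDim_quotient, Order.krullDim]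
  refine iSup_le fun s => ?_
  let t : LTSeries (PrimeSpectrum R) := s.map Subtype.val fun _ _ h => h
  have hlen : (s.length : ℕ∞) ≤ Order.coheight t.head := Order.length_le_coheight_head (p := t)
  have hht : 2 ≤ Order.height t.head := hI _ s.head.2
  have h := (Order.height_add_coheight_le_krullDim t.head).trans hR
  have h1 : Order.height t.head + Order.coheight t.head ≤ ((m + 2 : ℕ) : ℕ∞) := by
    exact WithBot.coe_le_coe.mp h
  have h2 : ((2 + s.length : ℕ) : ℕ∞) ≤ ((m + 2 : ℕ) : ℕ∞) := by
    push_cast at h1 ⊢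
    exact (add_le_add hht hlen).trans h1
  have h3 : s.length ≤ m := by
    have := Nat.cast_le.mp h2
    omega
  exact_mod_cast h3

theorem ringKrullDim_mvPolynomial_fin (n : ℕ) :
    ringKrullDim (MvPolynomial (Fin n) ℂ) = n := by
  rw [MvPolynomial.ringKrullDim_of_isNoetherianRing]
  simp

/-! ### Common zeros of coprime polynomials -/

/-- In at most one variable, coprime polynomials have no common zero: the ideal of such a zero would
be a prime of height two. -/
theorem eval_ne_zero_of_isRelPrime {n : ℕ} (hn : n ≤ 1) {P Q : MvPolynomial (Fin n) ℂ}
    (hPQ : IsRelPrime P Q) (z : Fin n → ℂ) (hP : eval z P = 0) : eval z Q ≠ 0 := by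
  intro hQ
  let x : PrimeSpectrum (MvPolynomial (Fin n) ℂ) :=
    ⟨RingHom.ker (eval z), RingHom.ker_isPrime _⟩
  have h2 := two_le_height_of_isRelPrime hPQ x hP hQ
  have h := Order.height_le_krullDim x
  have h3 : ((2 : ℕ∞) : WithBot ℕ∞) ≤ (n : WithBot ℕ∞) :=
    (WithBot.coe_le_coe.mpr h2).trans (h.trans (ringKrullDim_mvPolynomial_fin n).le)
  have h4 : 2 ≤ n := by exact_mod_cast h3
  omega

/-- The restriction of polynomials to the linear subspace `{z₀ = z₁ = 0}`. -/
noncomputable def restrictTail (m : ℕ) : MvPolynomial (Fin (m + 2)) ℂ →ₐ[ℂ] MvPolynomial (Fin m) ℂ :=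
  aeval (Fin.cons 0 (Fin.cons 0 X))

theorem restrictTail_surjective (m : ℕ) : Function.Surjective (restrictTail m) := by
  intro q
  refine ⟨rename (fun i => i.succ.succ) q, ?_⟩
  rw [restrictTail, aeval_rename]
  exact aeval_X_left_apply q

theorem eval_restrictTail {m : ℕ} (q : MvPolynomial (Fin (m + 2)) ℂ) (w : Fin m → ℂ) :
    eval w (restrictTail m q) = eval (Fin.cons 0 (Fin.cons 0 w)) q := by
  induction q using MvPolynomial.induction_on with
  | C a => simp [restrictTail]
  | add p q hp hq => simp [hp, hq]
  | mul_X p i hp =>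
    rw [map_mul, map_mul, map_mul, hp]
    congr 1
    refine Fin.cases ?_ (fun i => Fin.cases ?_ (fun i => ?_) i) i <;> simp [restrictTail]

theorem isRelPrime_X_X {m : ℕ} :
    IsRelPrime (X 0 : MvPolynomial (Fin (m + 2)) ℂ) (X 1) := by
  have h0 : Irreducible (X 0 : MvPolynomial (Fin (m + 2)) ℂ) := X_prime.irreducible
  refine (h0.isRelPrime_iff_not_dvd).mpr fun h => ?_
  rw [MvPolynomial.X_dvd_X] at h
  simp at h

/-- Coprime `P` and `Q` in `m + 2` variables vanish together only on an algebraic set of dimension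
exactly `m`. The set chosen is the union of their common zero set with `{z₀ = z₁ = 0}`, cut out by
the products of one generator of each. -/
theorem exists_isAlgebraicSet_algDim_eq {m : ℕ} {P Q : MvPolynomial (Fin (m + 2)) ℂ}
    (hPQ : IsRelPrime P Q) :
    ∃ A : Set (Fin (m + 2) → ℂ), IsAlgebraicSet A ∧ algDim A = (m : WithBot ℕ∞) ∧
      zeroSet P ∩ zeroSet Q ⊆ A := by
  classical
  let s : Finset (MvPolynomial (Fin (m + 2)) ℂ) := {P * X 0, P * X 1, Q * X 0, Q * X 1}
  refine ⟨⋂ p ∈ s, zeroSet p, ⟨s, rfl⟩, le_antisymm ?_ ?_, ?_⟩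
  · refine ringKrullDim_quotient_le_of_two_le_height
      (ringKrullDim_mvPolynomial_fin (m + 2)).le _ fun x hx => ?_
    have hmem : ∀ q ∈ s, q ∈ x.asIdeal := fun q hq =>
      hx fun z hz => Set.mem_iInter₂.mp hz q hq
    have hP0 := x.isPrime.mem_or_mem (hmem (P * X 0) (by simp [s]))
    have hP1 := x.isPrime.mem_or_mem (hmem (P * X 1) (by simp [s]))
    have hQ0 := x.isPrime.mem_or_mem (hmem (Q * X 0) (by simp [s]))
    have hQ1 := x.isPrime.mem_or_mem (hmem (Q * X 1) (by simp [s]))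
    by_cases h : P ∈ x.asIdeal ∧ Q ∈ x.asIdeal
    · exact two_le_height_of_isRelPrime hPQ x h.1 h.2
    · exact two_le_height_of_isRelPrime isRelPrime_X_X x (by tauto) (by tauto)
  · rw [← ringKrullDim_mvPolynomial_fin m]
    refine ringKrullDim_le_of_surjective
      (Ideal.Quotient.lift _ (restrictTail m).toRingHom fun q hq => ?_)
      (Ideal.Quotient.lift_surjective_of_surjective _ _ (restrictTail_surjective m))
    refine MvPolynomial.funext fun w => ?_
    have hw : (Fin.cons 0 (Fin.cons 0 w) : Fin (m + 2) → ℂ) ∈ ⋂ p ∈ s, zeroSet p := by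
      refine Set.mem_iInter₂.mpr fun p hp => ?_
      have h1 : (Fin.cons 0 (Fin.cons 0 w) : Fin (m + 2) → ℂ) 1 = 0 := rfl
      simp only [s, Finset.mem_insert, Finset.mem_singleton] at hp
      rcases hp with rfl | rfl | rfl | rfl <;> simp [zeroSet, h1]
    exact (eval_restrictTail q w).trans ((hq _ hw).trans (map_zero _).symm)
  · rintro z ⟨hP, hQ⟩
    simp only [zeroSet, Set.mem_ofPred_eq] at hP hQ
    refine Set.mem_iInter₂.mpr fun p hp => ?_
    simp only [s, Finset.mem_insert, Finset.mem_singleton] at hp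
    rcases hp with rfl | rfl | rfl | rfl <;> simp [zeroSet, hP, hQ]

/-! ### Boundary behaviour on the polydisk -/

theorem polydisk_eq_pi (n : ℕ) :
    polydisk n = Set.pi Set.univ fun _ => Metric.ball (0 : ℂ) 1 := by
  ext z
  simp [polydisk]

theorem isOpen_polydisk (n : ℕ) : IsOpen (polydisk n) := by
  rw [polydisk_eq_pi]
  exact isOpen_set_pi Set.finite_univ fun _ _ => Metric.isOpen_ball

theorem torus_subset_closure_polydisk (n : ℕ) : torus n ⊆ closure (polydisk n) := by
  intro z hz
  rw [polydisk_eq_pi, closure_pi_set]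
  intro i _
  rw [closure_ball _ one_ne_zero]
  simpa using (hz i).le

/-- If `φ * Q = P` on the polydisk with `φ` bounded, then `φ` has a limit at every point of the
torus where `P` or `Q` is nonzero. -/
theorem singularSet_subset_of_mul_eq {n : ℕ} {φ : (Fin n → ℂ) → ℂ} {C : ℝ}
    (hC : ∀ z ∈ polydisk n, ‖φ z‖ ≤ C) {P Q : MvPolynomial (Fin n) ℂ}
    (h : ∀ z ∈ polydisk n, φ z * eval z Q = eval z P) :
    singularSet φ ⊆ zeroSet P ∩ zeroSet Q := by
  rintro ζ ⟨hζ, hlim⟩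
  have : (𝓝[polydisk n] ζ).NeBot :=
    mem_closure_iff_nhdsWithin_neBot.mp (torus_subset_closure_polydisk n hζ)
  have hPt : Tendsto (fun z => eval z P) (𝓝[polydisk n] ζ) (𝓝 (eval ζ P)) :=
    (MvPolynomial.continuous_eval P).continuousWithinAt
  have hQt : Tendsto (fun z => eval z Q) (𝓝[polydisk n] ζ) (𝓝 (eval ζ Q)) :=
    (MvPolynomial.continuous_eval Q).continuousWithinAt
  have hQ : eval ζ Q = 0 := by
    by_contra hQ
    refine hlim ⟨_, (hPt.div hQt hQ).congr' ?_⟩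
    filter_upwards [self_mem_nhdsWithin, hQt.eventually_ne hQ] with z hz hz0
    rw [Pi.div_apply, ← h z hz, mul_div_cancel_right₀ _ hz0]
  refine ⟨?_, hQ⟩
  rw [hQ] at hQt
  have h0 : Tendsto (fun z => φ z * eval z Q) (𝓝[polydisk n] ζ) (𝓝 0) := by
    refine squeeze_zero_norm' (a := fun z => C * ‖eval z Q‖) ?_ ?_
    · filter_upwards [self_mem_nhdsWithin] with z hz
      rw [norm_mul]
      exact mul_le_mul_of_nonneg_right (hC z hz) (norm_nonneg _)
    · simpa using hQt.norm.const_mul C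
  refine tendsto_nhds_unique hPt (h0.congr' ?_)
  filter_upwards [self_mem_nhdsWithin] with z hz using h z hz

theorem eq_zero_of_eventually_eval_eq_zero {n : ℕ} {g : MvPolynomial (Fin n) ℂ} {z : Fin n → ℂ}
    (h : ∀ᶠ w in 𝓝 z, eval w g = 0) : g = 0 := by
  obtain ⟨ε, hε, hball⟩ := Metric.eventually_nhds_iff_ball.mp h
  refine MvPolynomial.funext_set (fun i => Metric.ball (z i) ε)
    (fun i => infinite_of_mem_nhds (z i) (Metric.ball_mem_nhds _ hε)) fun w hw => ?_
  rw [← ball_pi z hε] at hw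
  rw [hball w hw, map_zero]

/-- A rational inner function is a quotient of coprime polynomials. -/
theorem IsRationalInner.exists_isRelPrime {n : ℕ} {φ : (Fin n → ℂ) → ℂ}
    (hφ : IsRationalInner φ) : ∃ P Q : MvPolynomial (Fin n) ℂ, IsRelPrime P Q ∧
      ∀ z ∈ polydisk n, φ z * eval z Q = eval z P := by
  obtain ⟨hin, P, Q, hQ0, h⟩ := hφ
  obtain ⟨P', Q', g, hrel, rfl, rfl⟩ :=
    UniqueFactorizationMonoid.exists_reduced_factors' P Q hQ0
  refine ⟨P', Q', hrel, fun z hz => ?_⟩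
  -- If `φ * Q' ≠ P'` at `z`, then `g` vanishes near `z`, hence identically.
  by_contra hne
  refine hQ0 (mul_eq_zero_of_left (eq_zero_of_eventually_eval_eq_zero (z := z) ?_) Q')
  have hcont : ContinuousAt (fun w => φ w * eval w Q') z :=
    (hin.holomorphic.continuousOn.continuousAt ((isOpen_polydisk n).mem_nhds hz)).mul
      (MvPolynomial.continuous_eval Q').continuousAt
  filter_upwards [(isOpen_polydisk n).mem_nhds hz,
    (hcont.sub (MvPolynomial.continuous_eval P').continuousAt).eventually_ne
      (sub_ne_zero.mpr hne)] with w hw hwne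
  have hw' := h w hw
  simp only [map_mul] at hw'
  have : eval w g * (φ w * eval w Q' - eval w P') = 0 := by linear_combination hw'
  exact (mul_eq_zero.mp this).resolve_right hwne

theorem eval_reflection_eq_zero_of_mem_torus {n : ℕ} {p : MvPolynomial (Fin n) ℂ}
    {ζ : Fin n → ℂ} (hζ : ζ ∈ torus n) (hp : eval ζ p = 0) : eval ζ (reflection p) = 0 := by
  have hne : ∀ i, ζ i ≠ 0 := fun i => norm_ne_zero_iff.mp (by rw [hζ i]; exact one_ne_zero)
  have hinv : (fun i => 1 / star (ζ i)) = ζ := by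
    funext i
    rw [div_eq_iff (star_ne_zero.mpr (hne i))]
    simpa [hζ i] using (Complex.mul_conj' (ζ i)).symm
  rw [eval_reflection p ζ hne, hinv, hp, star_zero, mul_zero]

theorem proposition3p3 (n : ℕ) (φ : (Fin n → ℂ) → ℂ) (hφ : IsRationalInner φ) :
    (2 ≤ n → ∃ A : Set (Fin n → ℂ), IsAlgebraicSet A ∧
      algDim A = ((n - 2 : ℕ) : WithBot ℕ∞) ∧ singularSet φ ⊆ A) ∧
    (n ≤ 1 → singularSet φ = ∅) ∧
    (∀ (p : MvPolynomial (Fin n) ℂ) (h : Fin n → ℕ),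
      (∀ z ∈ polydisk n, MvPolynomial.eval z p ≠ 0) →
      (∀ z ∈ polydisk n, φ z =
        (∏ i, z i ^ h i) * MvPolynomial.eval z (reflection p) / MvPolynomial.eval z p) →
      singularSet φ ⊆ zeroSet p ∩ zeroSet (reflection p)) := by
  obtain ⟨P, Q, hrel, hPQ⟩ := hφ.exists_isRelPrime
  obtain ⟨K, hK⟩ := hφ.1.bounded
  have hS := singularSet_subset_of_mul_eq hK hPQ
  refine ⟨fun hn => ?_, fun hn => ?_, fun p h hp hφp ζ hζ => ?_⟩
  · obtain ⟨m, rfl⟩ := Nat.exists_eq_add_of_le' hn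
    obtain ⟨A, hA, hdim, hsub⟩ := exists_isAlgebraicSet_algDim_eq hrel
    exact ⟨A, hA, by simpa using hdim, hS.trans hsub⟩
  · refine Set.eq_empty_of_forall_notMem fun ζ hζ => ?_
    exact eval_ne_zero_of_isRelPrime hn hrel ζ (hS hζ).1 (hS hζ).2
  · have hpζ : eval ζ p = 0 := by
      refine (singularSet_subset_of_mul_eq hK
        (P := (∏ i, X i ^ h i) * reflection p) (Q := p) (fun z hz => ?_) hζ).2
      rw [hφp z hz, div_mul_cancel₀ _ (hp z hz)]
      simp
    exact ⟨hpζ, eval_reflection_eq_zero_of_mem_torus hζ.1 hpζ⟩
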